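/- Let $N\in\mathbb N$ and let $\{\Lambda_t\}_{t\ge 0}$ be a family of completely positive trace-preserving linear maps on the operators $\mathcal B(\mathbb C^N)$ with $\Lambda_0=\mathbb 1$, such that (i) $\frac{\mathrm d}{\mathrm dt}\Lambda_t=\gamma(t)\,\mathcal L\,\Lambda_t$ for all $t\ge 0$, where $\gamma:[0,\infty)\to\mathbb R$ is locally integrable and $\mathcal L$ is a diagonalizable linear map on $\mathcal B(\mathbb C^N)$ with only one non-zero eigenvalue $\ell\in\mathbb C$, i.e. $\mathcal L(\omega)=\ell\sum_{\alpha=1}^{d}\mathrm{Tr}[\varsigma_\alpha^\dagger\omega]\,\tau_\alpha$ for some $1\le d\le N^2$ and operators $\{\tau_\alpha\}_{\alpha=1}^{N^2},\{\varsigma_\alpha\}_{\alpha=1}^{N^2}$ with $\mathrm{Tr}[\varsigma_\alpha^\dagger\tau_\beta]=\delta_{\alpha\beta}$; (ii) $\frac{\mathrm d}{\mathrm dt}\Lambda_t=\int_0^t\mathrm d\tau\,\mathcal K^{\mathrm{NZ}}_{t-\tau}\Lambda_\tau$ for all $t\ge 0$, with a memory kernel $\mathcal K^{\mathrm{NZ}}_t=\mathcal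 A\,\delta(t)+k_t$, where $\mathcal A$ is a linear map on $\mathcal B(\mathbb C^N)$ (possibly $0$), $k$ is a locally integrable function on $[0,\infty)$ with values in the linear maps on $\mathcal B(\mathbb C^N)$, and the $\delta$ term is counted with full weight, so that the equation reads $\frac{\mathrm d}{\mathrm dt}\Lambda_t=\mathcal A\Lambda_t+\int_0^t\mathrm d\tau\,k_{t-\tau}\Lambda_\tau$. Put $G(t)=\frac{\mathrm d}{\mathrm dt}e^{\ell\int_0^t\gamma(\tau)\,\mathrm d\tau}$ and assume that its Laplace transform $\widetilde G(u)=\int_0^\infty e^{-ut}G(t)\,\mathrm dt$ converges absolutely and satisfies $|\widetilde G(u)|<1$ for all $u$ in some half-plane $\mathrm{Re}\,u>c$. Let $\{\Lambda^{\mathrm{Red}}_t\}_{t\ge 0}$ be the Redfield-like dynamics, i.e. $\Lambda^{\mathrm{Red}}_0=\mathbb 1$ and $$\frac{\mathrm d}{\mathrm dt}\Lambda^{\mathrm{Red}}_t=\mathcal K^{\mathrm{Red}}_t\Lambda^{\mathrm{Red}}_t,\qquad \mathcal K^{\mathrm{Red}}_t=\int_0^t\mathrm d\tau\,\mathcal K^{\mathrm{NZ}}_\tau=\mathcal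 A+\int_0^t\mathrm d\tau\,k_\tau\qquad(t\ge 0).$$ Call a family $\{\Phi_t\}_{t\ge 0}$ P-divisible (CP-divisible) if for all $0\le s\le t$ there is a positive (completely positive) trace-preserving linear map $V_{t,s}$ with $\Phi_t=V_{t,s}\Phi_s$. Then: if $\{\Lambda_t\}_{t\ge0}$ is P-divisible, so is $\{\Lambda^{\mathrm{Red}}_t\}_{t\ge0}$; and if $\{\Lambda_t\}_{t\ge0}$ is CP-divisible, so is $\{\Lambda^{\mathrm{Red}}_t\}_{t\ge0}$. -/

import Mathlib

open Matrix MeasureTheory Set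
open scoped ComplexOrder

noncomputable section

/-- Operators on the Hilbert space `ℂ^N`. -/
abbrev Op (N : ℕ) : Type := Matrix (Fin N) (Fin N) ℂ

/-- Super-operators: linear maps acting on the operators on `ℂ^N`. -/
abbrev SuperOp (N : ℕ) : Type := Op N →ₗ[ℂ] Op N

namespace SuperOp

/-- The map `𝟙_k ⊗ Φ`, applying `Φ` to each of the `k × k` blocks of an operator on `ℂ^k ⊗ ℂ^N`. -/
def ampliation {N : ℕ} (Φ : SuperOp N) (k : ℕ)
    (X : Matrix (Fin k × Fin N) (Fin k × Fin N) ℂ) :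
    Matrix (Fin k × Fin N) (Fin k × Fin N) ℂ :=
  Matrix.of fun p q => Φ (Matrix.of fun i j => X (p.1, i) (q.1, j)) p.2 q.2

/-- Positive maps. -/
def IsPositiveMap {N : ℕ} (Φ : SuperOp N) : Prop :=
  ∀ ω : Op N, ω.PosSemidef → (Φ ω).PosSemidef

/-- Completely positive maps: `𝟙_k ⊗ Φ` is positive for all `k`. -/
def IsCompletelyPositiveMap {N : ℕ} (Φ : SuperOp N) : Prop :=
  ∀ (k : ℕ) (X : Matrix (Fin k × Fin N) (Fin k × Fin N) ℂ),
    X.PosSemidef → (Φ.ampliation k X).PosSemidef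

/-- Trace-preserving maps. -/
def IsTracePreserving {N : ℕ} (Φ : SuperOp N) : Prop :=
  ∀ ω : Op N, (Φ ω).trace = ω.trace

/-- The map `Λ` is differentiable in time at `t ≥ 0` (one-sidedly at `t = 0`), with time
derivative `D`.  As the dimension is finite, this is expressed through matrix elements. -/
def HasTimeDeriv {N : ℕ} (Λ : ℝ → SuperOp N) (D : Op N → Op N) (t : ℝ) : Prop :=
  ∀ (ω : Op N) (i j : Fin N),
    HasDerivWithinAt (fun s => Λ s ω i j) (D ω i j) (Ici 0) t

/-- `{Λ_t}_{t ≥ 0}` is a family of dynamical maps: `Λ_0 = 𝟙` and each `Λ_t` is completely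
positive and trace preserving. -/
structure IsDynamicalMap {N : ℕ} (Λ : ℝ → SuperOp N) : Prop where
  zero : Λ 0 = LinearMap.id
  cp : ∀ t, 0 ≤ t → (Λ t).IsCompletelyPositiveMap
  tp : ∀ t, 0 ≤ t → (Λ t).IsTracePreserving

/-- `{Λ_t}_{t ≥ 0}` solves the time-local master equation `d/dt Λ_t = K_t Λ_t`, `Λ_0 = 𝟙`. -/
structure SolvesTimeLocal {N : ℕ} (K : ℝ → SuperOp N) (Λ : ℝ → SuperOp N) : Prop where
  zero : Λ 0 = LinearMap.id
  deriv : ∀ t, 0 ≤ t → HasTimeDeriv Λ (fun ω => K t (Λ t ω)) t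

/-- A memory kernel `K_t = inst · δ(t) + reg t`: a locally integrable super-operator valued function
`reg` on `[0, ∞)`, together with a possible instantaneous contribution `inst` at time zero
(`inst = 0` for kernels that are ordinary functions). -/
structure MemoryKernel (N : ℕ) where
  inst : SuperOp N
  reg : ℝ → SuperOp N
  integrableOn_reg : ∀ (ω : Op N) (i j : Fin N) (t : ℝ),
    IntegrableOn (fun s => reg s ω i j) (Ioc 0 t)

/-- The convolution `∫_0^t dτ K_{t-τ} Λ_τ`, applied to `ω`. -/
def MemoryKernel.conv {N : ℕ} (K : MemoryKernel N) (Λ : ℝ → SuperOp N) (t : ℝ) (ω : Op N) :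
    Op N :=
  K.inst (Λ t ω) + Matrix.of fun i j => ∫ τ in Ioc 0 t, K.reg (t - τ) (Λ τ ω) i j

/-- `{Λ_t}_{t ≥ 0}` solves the integro-differential master equation
`d/dt Λ_t = ∫_0^t dτ K_{t-τ} Λ_τ`, `Λ_0 = 𝟙`. -/
structure SolvesIntegroDifferential {N : ℕ} (K : MemoryKernel N) (Λ : ℝ → SuperOp N) : Prop where
  zero : Λ 0 = LinearMap.id
  deriv : ∀ t, 0 ≤ t → HasTimeDeriv Λ (K.conv Λ t) t

/-- The Redfield-like time-local generator `∫_0^t dτ K_τ` of a memory kernel `K`. -/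
def MemoryKernel.redfield {N : ℕ} (K : MemoryKernel N) (t : ℝ) : SuperOp N :=
  K.inst +
    { toFun := fun ω => Matrix.of fun i j => ∫ τ in Ioc 0 t, K.reg τ ω i j
      map_add' := fun ω ω' => by
        ext i j
        simpa using integral_add (K.integrableOn_reg ω i j t) (K.integrableOn_reg ω' i j t)
      map_smul' := fun c ω => by
        ext i j
        simp [integral_const_mul] }

/-- P-divisibility: for all `0 ≤ s ≤ t` there is a positive (trace-preserving) propagator
from time `s` to time `t`. -/
def IsPDivisible {N : ℕ} (Λ : ℝ → SuperOp N) : Prop :=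
  ∀ s t, 0 ≤ s → s ≤ t →
    ∃ V : SuperOp N, V.IsPositiveMap ∧ V.IsTracePreserving ∧ Λ t = V ∘ₗ Λ s

/-- CP-divisibility: for all `0 ≤ s ≤ t` there is a completely positive (trace-preserving)
propagator from time `s` to time `t`. -/
def IsCPDivisible {N : ℕ} (Λ : ℝ → SuperOp N) : Prop :=
  ∀ s t, 0 ≤ s → s ≤ t →
    ∃ V : SuperOp N, V.IsCompletelyPositiveMap ∧ V.IsTracePreserving ∧ Λ t = V ∘ₗ Λ s

/-- Damping bases: `N²` pairs of operators, bi-orthogonal for the Hilbert-Schmidt product. -/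
def IsDampingBasis {N : ℕ} (τ ς : Fin (N ^ 2) → Op N) : Prop :=
  ∀ α β, ((ς α)ᴴ * τ β).trace = if α = β then 1 else 0

/-- The rank-one super-operator `ω ↦ Tr[ς† ω] τ`. -/
def dyad {N : ℕ} (τ ς : Op N) : SuperOp N where
  toFun ω := (ςᴴ * ω).trace • τ
  map_add' ω ω' := by rw [mul_add, trace_add, add_smul]
  map_smul' c ω := by
    rw [mul_smul_comm, trace_smul, smul_assoc, RingHom.id_apply]

/-- `L` is diagonalizable with damping bases, and `ℓ` is its only non-zero eigenvalue, with
degeneracy `d`: `L = ℓ ∑_{α=1}^d M_α` where `M_α(ω) = Tr[ς_α† ω] τ_α`. -/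
def HasOnlyNonzeroEigenvalue {N : ℕ} (L : SuperOp N) (ℓ : ℂ) : Prop :=
  ℓ ≠ 0 ∧ ∃ τ ς : Fin (N ^ 2) → Op N, IsDampingBasis τ ς ∧
    ∃ d : ℕ, 1 ≤ d ∧ d ≤ N ^ 2 ∧
      L = ℓ • ∑ α : Fin (N ^ 2) with α.val < d, dyad (τ α) (ς α)

/-- The function `G(t) = d/dt exp(ℓ ∫_0^t γ(τ) dτ)`. -/
def G (ℓ : ℂ) (γ : ℝ → ℝ) (t : ℝ) : ℂ :=
  deriv (fun s : ℝ => Complex.exp (ℓ * ((∫ τ in (0 : ℝ)..s, γ τ : ℝ) : ℂ))) t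

end SuperOp

/-- The integrand of the Laplace transform of `f` at `u` is integrable. -/
def LaplaceConvergent (f : ℝ → ℂ) (u : ℂ) : Prop :=
  IntegrableOn (fun t : ℝ => Complex.exp (-u * t) * f t) (Ioi 0)

/-- The Laplace transform `∫_0^∞ e^{-ut} f(t) dt`. -/
def laplace (f : ℝ → ℂ) (u : ℂ) : ℂ :=
  ∫ t in Ioi (0 : ℝ), Complex.exp (-u * t) * f t

end

/-!
The generator is `L = ℓ P` with a projection `P`, so every dynamics occurring here is a curve in the
family `scaling P e = 𝟙 + (e - 1) P`, which is multiplicative in `e`. The exact dynamics is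
`scaling P (E t)` with `E' = g = ℓ γ E`; here `E` has no zeros because `log ‖E‖²` has an integrable
derivative (`ne_zero_of_hasDerivWithinAt_mul`).

Let `R(t)` be the integrated memory kernel. The integro-differential equation says that `R` vanishes
on the kernel of `P` and that `R + g * R = g P` on its range (Fubini's theorem on a triangle,
`convolution_eq_add_convolution_primitive`). Volterra equations with locally bounded kernel have
unique solutions by Grönwall's inequality, so `R(t) = r(t) P` where the
continuous scalar `r` is the resolvent of `g`: `r + g * r = g` (`exists_redfield_eq_smul`). Hence the Redfield-like dynamics is
`scaling P (exp (∫ r))`.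

If the exact dynamics is divisible, its propagators `scaling P (E t / E s)` are positive and trace
preserving. This forces `E t / E s` to be real and at most `1`
(`IsPositiveMap.im_eq_zero`, `IsPositiveMap.re_le_one`), so `E` decreases, `g ≤ 0`, and therefore
`r ≤ 0` (`resolvent_nonpos`). The Redfield propagators are then `scaling P q` with `0 < q ≤ 1`.
Unless `E` is constantly `1`, in which case `r = 0`, some `scaling P e` with `0 < e < 1` is
admissible, and so are its powers and their convex combinations with the identity, which exhaust
all `0 < q ≤ 1` (`scaling_mem_of_lt_one`). The argument only uses that the admissible maps are
positive, trace preserving, and closed under composition and convex combinations, so it covers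
positive and completely positive propagators at once.
-/

namespace SuperOp

variable {N : ℕ}

/-! ### Positive maps -/

lemma ampliation_comp (Φ Ψ : SuperOp N) (k : ℕ) (X : Matrix (Fin k × Fin N) (Fin k × Fin N) ℂ) :
    ampliation (Φ ∘ₗ Ψ) k X = Φ.ampliation k (Ψ.ampliation k X) := rfl

lemma ampliation_linearComb (Φ Ψ : SuperOp N) (a b : ℂ) (k : ℕ)
    (X : Matrix (Fin k × Fin N) (Fin k × Fin N) ℂ) :
    ampliation (a • Φ + b • Ψ) k X = a • Φ.ampliation k X + b • Ψ.ampliation k X := rfl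

lemma isPositiveMap_id : IsPositiveMap (LinearMap.id : SuperOp N) := fun _ h => h

lemma isCompletelyPositiveMap_id : IsCompletelyPositiveMap (LinearMap.id : SuperOp N) :=
  fun _ _ h => h

lemma isTracePreserving_id : IsTracePreserving (LinearMap.id : SuperOp N) := fun _ => rfl

lemma IsPositiveMap.comp {Φ Ψ : SuperOp N} (hΦ : Φ.IsPositiveMap) (hΨ : Ψ.IsPositiveMap) :
    IsPositiveMap (Φ ∘ₗ Ψ) := fun ω h => hΦ _ (hΨ ω h)

lemma IsCompletelyPositiveMap.comp {Φ Ψ : SuperOp N} (hΦ : Φ.IsCompletelyPositiveMap)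
    (hΨ : Ψ.IsCompletelyPositiveMap) : IsCompletelyPositiveMap (Φ ∘ₗ Ψ) :=
  fun k X h => ampliation_comp Φ Ψ k X ▸ hΦ k _ (hΨ k X h)

lemma IsTracePreserving.comp {Φ Ψ : SuperOp N} (hΦ : Φ.IsTracePreserving)
    (hΨ : Ψ.IsTracePreserving) : IsTracePreserving (Φ ∘ₗ Ψ) :=
  fun _ => (hΦ _).trans (hΨ _)

lemma IsPositiveMap.convexComb {Φ Ψ : SuperOp N} (hΦ : Φ.IsPositiveMap) (hΨ : Ψ.IsPositiveMap)
    {a b : ℝ} (ha : 0 ≤ a) (hb : 0 ≤ b) : IsPositiveMap ((a : ℂ) • Φ + (b : ℂ) • Ψ) := fun ω h => by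
  have ha' : (0 : ℂ) ≤ a := by exact_mod_cast ha
  have hb' : (0 : ℂ) ≤ b := by exact_mod_cast hb
  exact ((hΦ ω h).smul ha').add ((hΨ ω h).smul hb')

lemma IsCompletelyPositiveMap.convexComb {Φ Ψ : SuperOp N} (hΦ : Φ.IsCompletelyPositiveMap)
    (hΨ : Ψ.IsCompletelyPositiveMap) {a b : ℝ} (ha : 0 ≤ a) (hb : 0 ≤ b) :
    IsCompletelyPositiveMap ((a : ℂ) • Φ + (b : ℂ) • Ψ) := fun k X h => by
  rw [ampliation_linearComb]
  have ha' : (0 : ℂ) ≤ a := by exact_mod_cast ha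
  have hb' : (0 : ℂ) ≤ b := by exact_mod_cast hb
  exact ((hΦ k X h).smul ha').add ((hΨ k X h).smul hb')

lemma IsTracePreserving.convexComb {Φ Ψ : SuperOp N} (hΦ : Φ.IsTracePreserving)
    (hΨ : Ψ.IsTracePreserving) {a b : ℝ} (hab : a + b = 1) :
    IsTracePreserving ((a : ℂ) • Φ + (b : ℂ) • Ψ) := fun ω => by
  have : (a : ℂ) + b = 1 := by exact_mod_cast hab
  simp [hΦ ω, hΨ ω, ← add_mul, this]

lemma IsCompletelyPositiveMap.isPositiveMap {Φ : SuperOp N} (hΦ : Φ.IsCompletelyPositiveMap) :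
    Φ.IsPositiveMap := fun _ h =>
  (hΦ 1 _ (h.submatrix Prod.snd)).submatrix fun i => ((0 : Fin 1), i)

/-- A super-operator that vanishes on the positive semidefinite operators vanishes, since these
span all operators. -/
lemma eq_zero_of_forall_posSemidef {Φ : SuperOp N}
    (h : ∀ ω : Op N, ω.PosSemidef → Φ ω = 0) : Φ = 0 := by
  open scoped MatrixOrder Matrix.Norms.L2Operator in
  have hspan := CStarAlgebra.span_nonneg (A := Op N)
  refine LinearMap.ext_on hspan fun ω hω => ?_
  exact h ω (Matrix.nonneg_iff_posSemidef.mp hω)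

/-! ### The family `𝟙 + (e - 1) P` of a projection `P` -/

/-- The super-operator acting as multiplication by `e` on the range of the projection `P` and as
the identity on its kernel. -/
def scaling (P : SuperOp N) (e : ℂ) : SuperOp N := LinearMap.id + (e - 1) • P

variable {P : SuperOp N}

lemma scaling_apply (e : ℂ) (ω : Op N) : scaling P e ω = ω + (e - 1) • P ω := rfl

@[simp] lemma scaling_one : scaling P 1 = LinearMap.id := by simp [scaling]

lemma scaling_comp (hP : P ∘ₗ P = P) (e e' : ℂ) :
    scaling P e ∘ₗ scaling P e' = scaling P (e * e') := by
  have hP' : ∀ ω, P (P ω) = P ω := fun ω => LinearMap.congr_fun hP ω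
  refine LinearMap.ext fun ω => ?_
  simp only [LinearMap.comp_apply, scaling_apply, map_add, map_smul, hP']
  module

lemma convexComb_scaling {a b : ℝ} (hab : a + b = 1) (e : ℂ) :
    (a : ℂ) • LinearMap.id + (b : ℂ) • scaling P e = scaling P (a + b * e) := by
  have : (a : ℂ) = 1 - b := by rw [eq_sub_iff_add_eq]; exact_mod_cast hab
  rw [this, scaling, scaling]
  module

/-- A propagator between two invertible members of the family is the member at the ratio. -/
lemma eq_scaling_div (hP : P ∘ₗ P = P) {V : SuperOp N} {e e' : ℂ} (he' : e' ≠ 0)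
    (hV : scaling P e = V ∘ₗ scaling P e') : V = scaling P (e / e') := by
  rw [div_eq_mul_inv, ← scaling_comp hP, hV, LinearMap.comp_assoc, scaling_comp hP,
    mul_inv_cancel₀ he', scaling_one, LinearMap.comp_id]

/-- If `𝟙 + (e - 1) P` is positive, so is its square `𝟙 + (e² - 1) P`; both preserve Hermiticity,
which forces `e` to be real. -/
lemma IsPositiveMap.im_eq_zero (hP : P ∘ₗ P = P) (hP0 : P ≠ 0) {e : ℂ}
    (h : (scaling P e).IsPositiveMap) : e.im = 0 := by
  obtain ⟨ω, hω, hPω⟩ : ∃ ω : Op N, ω.PosSemidef ∧ P ω ≠ 0 := by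
    by_contra! hc
    exact hP0 (eq_zero_of_forall_posSemidef hc)
  by_cases he : e = 1
  · simp [he]
  have herm : ∀ e', (scaling P e').IsPositiveMap → ((e' - 1) • P ω).IsHermitian := by
    intro e' h'
    have := (h' ω hω).isHermitian.sub hω.isHermitian
    rwa [scaling_apply, add_sub_cancel_left] at this
  set H := (e - 1) • P ω with hH
  have hH0 : H ≠ 0 := smul_ne_zero (sub_ne_zero.mpr he) hPω
  have h1 : Hᴴ = H := herm e h
  have h2 : ((e + 1) • H)ᴴ = (e + 1) • H := by
    have : (e + 1) • H = (e * e - 1) • P ω := by rw [hH]; module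
    rw [this]
    exact herm _ (scaling_comp hP e e ▸ h.comp h)
  rw [conjTranspose_smul, h1] at h2
  have h3 := smul_left_injective ℂ hH0 h2
  have h4 := congrArg Complex.im h3
  simp at h4
  linarith

/-- If `𝟙 + (e - 1) P` is positive and trace preserving with `e > 1`, all powers
`𝟙 + (eⁿ - 1) P` are positive, so `P` maps positive operators to positive ones; but it also maps
them to operators of trace zero, so it vanishes. -/
lemma IsPositiveMap.re_le_one (hP : P ∘ₗ P = P) (hP0 : P ≠ 0) {e : ℝ}
    (h : (scaling P e).IsPositiveMap) (htr : (scaling P e).IsTracePreserving) : e ≤ 1 := by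
  by_contra! he
  refine hP0 (eq_zero_of_forall_posSemidef fun ω hω => ?_)
  have hpow : ∀ n : ℕ, (scaling P ((e ^ n : ℝ) : ℂ)).IsPositiveMap := by
    intro n
    induction n with
    | zero => simpa using isPositiveMap_id
    | succ n ih =>
      have := ih.comp h
      rw [scaling_comp hP] at this
      simpa [pow_succ] using this
  have he' : ((e : ℂ) - 1) ≠ 0 := by
    rw [sub_ne_zero]; exact_mod_cast he.ne'
  have htr0 : (P ω).trace = 0 := by
    have := htr ω
    simpa [scaling_apply, he'] using this
  have hherm : (P ω).IsHermitian := by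
    have := ((h ω hω).isHermitian.sub hω.isHermitian)
    rw [scaling_apply, add_sub_cancel_left, IsHermitian, conjTranspose_smul] at this
    have hs : star ((e : ℂ) - 1) = (e : ℂ) - 1 := by simp
    rw [hs] at this
    exact smul_right_injective _ he' this
  have hpos : (P ω).PosSemidef := by
    refine .of_dotProduct_mulVec_nonneg hherm fun x => ?_
    have him : (star x ⬝ᵥ P ω *ᵥ x).im = 0 := hherm.im_star_dotProduct_mulVec_self x
    suffices 0 ≤ (star x ⬝ᵥ P ω *ᵥ x).re from Complex.nonneg_iff.mpr ⟨this, him.symm⟩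
    by_contra! hneg
    obtain ⟨n, hn⟩ := pow_unbounded_of_one_lt
      (1 + (star x ⬝ᵥ ω *ᵥ x).re / (-(star x ⬝ᵥ P ω *ᵥ x).re)) he
    have hn' := (Complex.nonneg_iff.mp ((hpow n ω hω).dotProduct_mulVec_nonneg x)).1
    rw [scaling_apply, add_mulVec, smul_mulVec, dotProduct_add, dotProduct_smul, smul_eq_mul,
      ← Complex.ofReal_one, ← Complex.ofReal_sub, Complex.add_re, Complex.re_ofReal_mul] at hn'
    have hn2 := (div_lt_iff₀ (neg_pos.mpr hneg)).mp (lt_sub_iff_add_lt'.mpr hn)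
    linarith
  exact hpos.trace_eq_zero_iff.mp htr0

/-- The projection behind a generator with a single non-zero eigenvalue. -/
lemma HasOnlyNonzeroEigenvalue.exists_projection {L : SuperOp N} {ℓ : ℂ}
    (hL : HasOnlyNonzeroEigenvalue L ℓ) : ∃ P : SuperOp N, P ∘ₗ P = P ∧ P ≠ 0 ∧ L = ℓ • P := by
  obtain ⟨-, τ, ς, hb, d, hd1, hdN, hL⟩ := hL
  have happ : ∀ ω, (∑ α : Fin (N ^ 2) with α.val < d, dyad (τ α) (ς α)) ω =
      ∑ α : Fin (N ^ 2) with α.val < d, ((ς α)ᴴ * ω).trace • τ α := fun ω => by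
    rw [LinearMap.sum_apply]; rfl
  have hτ : ∀ β : Fin (N ^ 2), β.val < d →
      (∑ α : Fin (N ^ 2) with α.val < d, dyad (τ α) (ς α)) (τ β) = τ β := fun β hβ => by
    rw [happ, Finset.sum_eq_single β]
    · simp [hb β β]
    · intro α _ hα
      simp [hb α β, hα]
    · intro h; simp [hβ] at h
  refine ⟨_, LinearMap.ext fun ω => ?_, fun h0 => ?_, hL⟩
  · rw [LinearMap.comp_apply]
    conv_lhs => rw [happ ω]
    rw [map_sum, happ ω]
    refine Finset.sum_congr rfl fun α hα => ?_
    rw [map_smul, hτ α (by simpa using hα)]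
  · have h := hτ ⟨0, by omega⟩ hd1
    rw [h0, LinearMap.zero_apply] at h
    have := hb ⟨0, by omega⟩ ⟨0, by omega⟩
    simp [← h] at this

end SuperOp

/-! ### Scalar Volterra equations -/

/-- Integral form of Grönwall's inequality without inhomogeneity. -/
lemma nonpos_of_le_mul_integral {m : ℝ → ℝ} {C T : ℝ} (hm : ContinuousOn m (Ici 0))
    (hm0 : ∀ t, 0 ≤ t → 0 ≤ m t)
    (h : ∀ t ∈ Icc 0 T, m t ≤ C * ∫ s in (0 : ℝ)..t, m s) :
    ∀ t ∈ Icc 0 T, m t ≤ 0 := by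
  set m' : ℝ → ℝ := fun t => m (max t 0) with hm'
  have hc : Continuous m' :=
    hm.comp_continuous (continuous_id.max continuous_const) fun t => mem_Ici.mpr (le_max_right _ _)
  have hint : ∀ t, 0 ≤ t → ∫ s in (0 : ℝ)..t, m s = ∫ s in (0 : ℝ)..t, m' s := fun t ht =>
    intervalIntegral.integral_congr fun s hs => by
      rw [uIcc_of_le ht] at hs
      simp [hm', hs.1]
  have hd : ∀ t, HasDerivAt (fun t => ∫ s in (0 : ℝ)..t, m' s) (m' t) t := fun t =>
    intervalIntegral.integral_hasDerivAt_right (hc.intervalIntegrable _ _)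
      hc.aestronglyMeasurable.stronglyMeasurableAtFilter hc.continuousAt
  have hM0 : ∀ t, 0 ≤ t → 0 ≤ ∫ s in (0 : ℝ)..t, m' s := fun t ht =>
    intervalIntegral.integral_nonneg ht fun s _ => hm0 _ (le_max_right _ _)
  have hzero := eq_zero_of_abs_deriv_le_mul_abs_self_of_eq_zero_right (K := C) (a := 0) (b := T)
    (fun t _ => (hd t).continuousAt.continuousWithinAt)
    (fun t _ => (hd t).hasDerivWithinAt) (by simp) fun t ht => by
      rw [Real.norm_of_nonneg (hM0 t ht.1), Real.norm_of_nonneg (hm0 _ (le_max_right _ _)),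
        ← hint t ht.1]
      simpa [hm', ht.1] using h t ⟨ht.1, ht.2.le⟩
  intro t ht
  have := h t ht
  rwa [hint t ht.1, hzero t ht, mul_zero] at this

/-- A continuous `m ≥ 0` dominated by its own convolution with a bounded function `f ≥ 0`
vanishes. -/
lemma nonpos_of_le_convolution {m f : ℝ → ℝ} {C T : ℝ} (hm : ContinuousOn m (Ici 0))
    (hm0 : ∀ t, 0 ≤ t → 0 ≤ m t)
    (hfi : ∀ t ∈ Icc 0 T, IntervalIntegrable f volume 0 t)
    (hf : ∀ t ∈ Icc 0 T, f t ≤ C)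
    (h : ∀ t ∈ Icc 0 T, m t ≤ ∫ s in (0 : ℝ)..t, f s * m (t - s)) :
    ∀ t ∈ Icc 0 T, m t ≤ 0 := by
  refine nonpos_of_le_mul_integral (C := C) hm hm0 fun t ht => (h t ht).trans ?_
  have hmt : ContinuousOn (fun s => m (t - s)) (uIcc 0 t) :=
    hm.comp (by fun_prop) fun s hs => by
      rw [uIcc_of_le ht.1] at hs
      exact sub_nonneg.mpr hs.2
  calc ∫ s in (0 : ℝ)..t, f s * m (t - s)
      ≤ ∫ s in (0 : ℝ)..t, C * m (t - s) := by
        refine intervalIntegral.integral_mono_on ht.1 ((hfi t ht).mul_continuousOn hmt)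
          (hmt.intervalIntegrable.const_mul C) fun s hs => ?_
        exact mul_le_mul_of_nonneg_right (hf s ⟨hs.1, hs.2.trans ht.2⟩)
          (hm0 _ (sub_nonneg.mpr hs.2))
    _ = C * ∫ s in (0 : ℝ)..t, m s := by
        rw [intervalIntegral.integral_const_mul,
          intervalIntegral.integral_comp_sub_left (fun s => m s) t]
        simp

/-- Fubini's theorem on the triangle `0 < s`, `0 < τ`, `s + τ ≤ t`. -/
lemma integral_mul_integral_sub_comm {f k : ℝ → ℂ} {t : ℝ}
    (hf : IntegrableOn f (Ioc 0 t)) (hk : IntegrableOn k (Ioc 0 t)) :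
    ∫ τ in Ioc 0 t, f τ * ∫ s in Ioc 0 (t - τ), k s =
      ∫ s in Ioc 0 t, k s * ∫ τ in Ioc 0 (t - s), f τ := by
  have key : ∀ f k : ℝ → ℂ, ∫ τ in Ioc 0 t, f τ * ∫ s in Ioc 0 (t - τ), k s =
      ∫ τ in Ioc 0 t, ∫ s in Ioc 0 t,
        {p : ℝ × ℝ | p.1 + p.2 ≤ t}.indicator (fun p => f p.1 * k p.2) (τ, s) := by
    intro f k
    refine setIntegral_congr_fun measurableSet_Ioc fun τ hτ => ?_
    have : ∀ s, {p : ℝ × ℝ | p.1 + p.2 ≤ t}.indicator (fun p => f p.1 * k p.2) (τ, s) =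
        (Iic (t - τ)).indicator (fun s => f τ * k s) s := fun s => by
      simp [indicator, le_sub_iff_add_le']
    simp_rw [this]
    rw [setIntegral_indicator measurableSet_Iic, integral_const_mul, Ioc_inter_Iic,
      min_eq_right (by linarith [hτ.1])]
  rw [key, key, integral_integral_swap]
  · simp only [indicator, mem_ofPred_eq, add_comm, mul_comm]
  · exact (hf.mul_prod hk).indicator (measurableSet_le (by fun_prop) (by fun_prop))

/-- With `E = 1 + ∫ g`, the memory integral of `A δ + k` against `E` is `R + g * R`, where
`R = A + ∫ k`. -/
lemma convolution_eq_add_convolution_primitive {E g k : ℝ → ℂ} {A : ℂ} {t : ℝ} (ht : 0 ≤ t)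
    (hg : IntegrableOn g (Ioc 0 t)) (hk : IntegrableOn k (Ioc 0 t))
    (hE : ∀ s ∈ Icc 0 t, E s = 1 + ∫ τ in Ioc 0 s, g τ) :
    E t * A + ∫ τ in Ioc 0 t, E τ * k (t - τ) =
      (A + ∫ s in Ioc 0 t, k s) +
        ∫ τ in Ioc 0 t, g τ * (A + ∫ s in Ioc 0 (t - τ), k s) := by
  have hrefl : ∫ τ in Ioc 0 t, E τ * k (t - τ) = ∫ τ in Ioc 0 t, k τ * E (t - τ) := by
    rw [← intervalIntegral.integral_of_le ht, ← intervalIntegral.integral_of_le ht]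
    have := intervalIntegral.integral_comp_sub_left (a := 0) (b := t)
      (fun s => k s * E (t - s)) t
    simp only [sub_sub_cancel, sub_self, sub_zero] at this
    rw [← this]
    exact intervalIntegral.integral_congr fun s _ => mul_comm _ _
  have hgk : ∀ a b : ℝ → ℂ, IntegrableOn a (Ioc 0 t) → IntegrableOn b (Ioc 0 t) →
      IntegrableOn (fun τ => a τ * ∫ s in Ioc 0 (t - τ), b s) (Ioc 0 t) := by
    intro a b ha hb
    have hb' : ContinuousOn (fun s => ∫ τ in Ioc 0 s, b τ) (Icc 0 t) :=
      intervalIntegral.continuousOn_primitive (by rwa [integrableOn_Icc_iff_integrableOn_Ioc])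
    have hb2 : ContinuousOn (fun τ => ∫ s in Ioc 0 (t - τ), b s) (uIcc 0 t) :=
      hb'.comp (by fun_prop) fun s hs => by
        rw [uIcc_of_le ht] at hs
        exact ⟨sub_nonneg.mpr hs.2, sub_le_self _ hs.1⟩
    have := ((intervalIntegrable_iff_integrableOn_Ioc_of_le ht).mpr ha).mul_continuousOn hb2
    exact (intervalIntegrable_iff_integrableOn_Ioc_of_le ht).mp this
  have h1 : ∫ τ in Ioc 0 t, k τ * E (t - τ) =
      (∫ s in Ioc 0 t, k s) + ∫ s in Ioc 0 t, k s * ∫ τ in Ioc 0 (t - s), g τ := by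
    rw [← integral_add hk (hgk k g hk hg)]
    refine setIntegral_congr_fun measurableSet_Ioc fun s hs => ?_
    rw [hE (t - s) ⟨sub_nonneg.mpr hs.2, sub_le_self _ hs.1.le⟩, mul_add, mul_one]
  have h2 : ∫ τ in Ioc 0 t, g τ * (A + ∫ s in Ioc 0 (t - τ), k s) =
      (∫ τ in Ioc 0 t, g τ) * A + ∫ τ in Ioc 0 t, g τ * ∫ s in Ioc 0 (t - τ), k s := by
    rw [← integral_mul_const, ← integral_add (hg.mul_const A) (hgk g k hg hk)]
    exact setIntegral_congr_fun measurableSet_Ioc fun s hs => mul_add _ _ _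
  rw [hrefl, h1, h2, integral_mul_integral_sub_comm hg hk, hE t ⟨ht, le_rfl⟩]
  ring

/-! ### Scalar linear differential equations on the half-line -/

/-- A function on `[0, ∞)` whose one-sided derivative vanishes is constant. -/
lemma eq_of_hasDerivWithinAt_Ici_zero {f : ℝ → ℂ}
    (hf : ∀ t, 0 ≤ t → HasDerivWithinAt f 0 (Ici 0) t) {t : ℝ} (ht : 0 ≤ t) : f t = f 0 := by
  refine constant_of_has_deriv_right_zero (a := 0) (b := t)
    (fun s hs => (hf s hs.1).continuousWithinAt.mono Icc_subset_Ici_self)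
    (fun s hs => (hf s hs.1).mono (Ici_subset_Ici.mpr hs.1)) t ⟨ht, le_rfl⟩

/-- A solution of `a' = κ a` with integrable `κ` has no zero if `a 0 = 1`: before its first zero
`log ‖a‖²` has the integrable derivative `2 Re κ`, so it is bounded below. -/
lemma ne_zero_of_hasDerivWithinAt_mul {a κ : ℝ → ℂ} (ha0 : a 0 = 1)
    (hκ : ∀ t, IntegrableOn κ (Ioc 0 t))
    (ha : ∀ t, 0 ≤ t → HasDerivWithinAt a (κ t * a t) (Ici 0) t) {t : ℝ} (ht : 0 ≤ t) :
    a t ≠ 0 := by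
  intro hat
  have hcont : ContinuousOn a (Ici 0) := fun s hs => (ha s hs).continuousWithinAt
  have hcl : IsCompact {s ∈ Icc 0 t | a s = 0} :=
    isCompact_Icc.of_isClosed_subset
      ((hcont.mono Icc_subset_Ici_self).preimage_isClosed_of_isClosed isClosed_Icc
        (isClosed_singleton (x := (0 : ℂ)))) fun s hs => hs.1
  obtain ⟨s, ⟨⟨hs0, hst⟩, has⟩, hmin⟩ := hcl.exists_isLeast ⟨t, ⟨ht, le_rfl⟩, hat⟩
  have hspos : 0 < s := hs0.lt_of_ne fun h => by simp [← h, ha0] at has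
  have hne : ∀ x ∈ Ico 0 s, a x ≠ 0 := fun x hx h =>
    (hmin ⟨⟨hx.1, hx.2.le.trans hst⟩, h⟩).not_gt hx.2
  have hκr : IntegrableOn (fun x => 2 * (κ x).re) (Ioc 0 s) := (hκ s).re.const_mul 2
  have hlog : ∀ x ∈ Ico 0 s, ∫ y in (0 : ℝ)..x, 2 * (κ y).re = Real.log (‖a x‖ ^ 2) := by
    intro x hx
    have hsub : Icc 0 x ⊆ Ico 0 s := fun y hy => ⟨hy.1, hy.2.trans_lt hx.2⟩
    have hd : ∀ y ∈ Ico 0 s,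
        HasDerivWithinAt (fun y => Real.log (‖a y‖ ^ 2)) (2 * (κ y).re) (Ici 0) y := by
      intro y hy
      have hn : ‖a y‖ ^ 2 ≠ 0 := by simpa using hne y hy
      convert (ha y hy.1).norm_sq.log hn using 1
      rw [eq_div_iff hn, Complex.inner, ← Complex.normSq_eq_norm_sq, Complex.normSq_apply]
      simp
      ring
    rw [intervalIntegral.integral_eq_sub_of_hasDeriv_right_of_le hx.1
      (fun y hy => (hd y (hsub hy)).continuousWithinAt.mono Icc_subset_Ici_self)
      (fun y hy => (hd y (hsub (Ioo_subset_Icc_self hy))).mono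
        fun z hz => hy.1.le.trans (le_of_lt hz))
      ((intervalIntegrable_iff_integrableOn_Ioc_of_le hx.1).mpr
        (hκr.mono_set (Ioc_subset_Ioc_right hx.2.le)))]
    simp [ha0]
  have hprim : ContinuousOn (fun x => ∫ y in Ioc 0 x, 2 * (κ y).re) (Icc 0 s) :=
    intervalIntegral.continuousOn_primitive (by rwa [integrableOn_Icc_iff_integrableOn_Ioc])
  have heq : EqOn (fun x => ‖a x‖ ^ 2) (fun x => Real.exp (∫ y in Ioc 0 x, 2 * (κ y).re))
      (Icc 0 s) := by
    refine EqOn.of_subset_closure (s := Ico 0 s) (fun x hx => ?_)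
      ((hcont.mono Icc_subset_Ici_self).norm.pow 2) hprim.rexp Ico_subset_Icc_self
      (by rw [closure_Ico hspos.ne])
    have hn : 0 < ‖a x‖ ^ 2 := by have := hne x hx; positivity
    rw [← intervalIntegral.integral_of_le hx.1, hlog x hx, Real.exp_log hn]
  have := heq ⟨hs0, le_rfl⟩
  simp only [has] at this
  simp at this
  exact absurd this.symm (Real.exp_pos _).ne'

/-- The exponential of the primitive of a continuous `r` solves `F' = r F`. -/
lemma exists_exp_primitive {r : ℝ → ℂ} (hr : ContinuousOn r (Ici 0)) :
    ∃ F : ℝ → ℂ, (∀ t, 0 ≤ t → F t = Complex.exp (∫ s in (0 : ℝ)..t, r s)) ∧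
      ∀ t, 0 ≤ t → HasDerivWithinAt F (r t * F t) (Ici 0) t := by
  set r' : ℝ → ℂ := fun t => r (max t 0) with hr'
  have hc : Continuous r' :=
    hr.comp_continuous (continuous_id.max continuous_const) fun t => mem_Ici.mpr (le_max_right _ _)
  refine ⟨fun t => Complex.exp (∫ s in (0 : ℝ)..t, r' s), fun t ht => ?_, fun t ht => ?_⟩
  · rw [hr']
    refine congrArg Complex.exp (intervalIntegral.integral_congr fun s hs => ?_)
    rw [uIcc_of_le ht] at hs
    simp [hs.1]
  · have hd : HasDerivAt (fun t => ∫ s in (0 : ℝ)..t, r' s) (r' t) t :=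
      intervalIntegral.integral_hasDerivAt_right (hc.intervalIntegrable _ _)
        hc.aestronglyMeasurable.stronglyMeasurableAtFilter hc.continuousAt
    have := hd.cexp.hasDerivWithinAt (s := Ici 0)
    rw [mul_comm] at this
    simpa [hr', ht] using this

/-! ### The resolvent of a convolution equation -/

lemma continuousOn_Ici_primitive {k : ℝ → ℂ} (hk : ∀ t, IntegrableOn k (Ioc 0 t)) :
    ContinuousOn (fun t => ∫ s in Ioc 0 t, k s) (Ici 0) := by
  intro t ht
  have h : ContinuousOn (fun t => ∫ s in Ioc 0 t, k s) (Icc 0 (t + 1)) :=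
    intervalIntegral.continuousOn_primitive
      (by rw [integrableOn_Icc_iff_integrableOn_Ioc]; exact hk _)
  refine (h t ⟨ht, by linarith⟩).mono_of_mem_nhdsWithin ?_
  rw [← Ici_inter_Iic]
  exact inter_mem_nhdsWithin _ (Iic_mem_nhds (by linarith))

lemma continuousOn_comp_sub {D : ℝ → ℂ} (hD : ContinuousOn D (Ici 0)) (t : ℝ) :
    ContinuousOn (fun τ => D (t - τ)) (Icc 0 t) :=
  hD.comp (by fun_prop) fun _ hτ => sub_nonneg.mpr hτ.2

lemma integrableOn_mul_comp_sub {g D : ℝ → ℂ} {t : ℝ} (hg : IntegrableOn g (Ioc 0 t))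
    (hD : ContinuousOn D (Ici 0)) : IntegrableOn (fun τ => g τ * D (t - τ)) (Ioc 0 t) := by
  rw [← integrableOn_Icc_iff_integrableOn_Ioc] at hg ⊢
  exact hg.mul_continuousOn (continuousOn_comp_sub hD t) isCompact_Icc

/-- A solution `g` of `r + g * r = g` with `r` continuous is locally bounded. -/
lemma exists_bound_of_resolvent {g r : ℝ → ℂ} (hg : ∀ t, IntegrableOn g (Ioc 0 t))
    (hr : ContinuousOn r (Ici 0))
    (h : ∀ t, 0 ≤ t → r t + ∫ τ in Ioc 0 t, g τ * r (t - τ) = g t) (T : ℝ) :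
    ∃ C, ∀ t ∈ Icc 0 T, ‖g t‖ ≤ C := by
  obtain ⟨M, hM⟩ := isCompact_Icc.exists_bound_of_continuousOn
    (hr.mono (Icc_subset_Ici_self : Icc 0 T ⊆ Ici 0))
  refine ⟨M + ∫ τ in Ioc 0 T, ‖g τ‖ * M, fun t ht => ?_⟩
  have hM0 : 0 ≤ M := (norm_nonneg _).trans (hM t ht)
  rw [← h t ht.1]
  refine (norm_add_le _ _).trans (add_le_add (hM t ht) ?_)
  refine (norm_integral_le_integral_norm _).trans ?_
  calc ∫ τ in Ioc 0 t, ‖g τ * r (t - τ)‖ ≤ ∫ τ in Ioc 0 t, ‖g τ‖ * M := by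
        refine setIntegral_mono_on (integrableOn_mul_comp_sub (hg t) hr).norm
          ((hg t).norm.mul_const M) measurableSet_Ioc fun τ hτ => ?_
        rw [norm_mul]
        exact mul_le_mul_of_nonneg_left
          (hM _ ⟨sub_nonneg.mpr hτ.2, by linarith [hτ.1, ht.2]⟩) (norm_nonneg _)
    _ ≤ ∫ τ in Ioc 0 T, ‖g τ‖ * M :=
        setIntegral_mono_set ((hg T).norm.mul_const M)
          (Filter.Eventually.of_forall fun τ => mul_nonneg (norm_nonneg _) hM0)
          (Ioc_subset_Ioc_right ht.2).eventuallyLE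

/-- Uniqueness for Volterra equations with a locally bounded kernel. -/
lemma eq_zero_of_add_convolution_eq_zero {g D : ℝ → ℂ} (hg : ∀ t, IntegrableOn g (Ioc 0 t))
    (hgb : ∀ T, ∃ C, ∀ t ∈ Icc 0 T, ‖g t‖ ≤ C) (hD : ContinuousOn D (Ici 0))
    (h : ∀ t, 0 ≤ t → D t + ∫ τ in Ioc 0 t, g τ * D (t - τ) = 0) {t : ℝ} (ht : 0 ≤ t) :
    D t = 0 := by
  obtain ⟨C, hC⟩ := hgb t
  refine norm_le_zero_iff.mp (nonpos_of_le_convolution (m := fun t => ‖D t‖)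
    (f := fun t => ‖g t‖) (C := C) (T := t) hD.norm (fun _ _ => norm_nonneg _)
    (fun s hs => (intervalIntegrable_iff_integrableOn_Ioc_of_le hs.1).mpr (hg s).norm)
    hC (fun s hs => ?_) t ⟨ht, le_rfl⟩)
  rw [intervalIntegral.integral_of_le hs.1, eq_neg_of_add_eq_zero_left (h s hs.1), norm_neg]
  refine (norm_integral_le_integral_norm _).trans_eq ?_
  simp only [norm_mul]

/-- The resolvent `r` of a real non-positive `g` is real and non-positive: the equation
`r + g * r = g` reads `-r = (-g) + (-g) * (-r)`. -/
lemma resolvent_nonpos {g r : ℝ → ℂ} (hg : ∀ t, IntegrableOn g (Ioc 0 t))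
    (hr : ContinuousOn r (Ici 0))
    (h : ∀ t, 0 ≤ t → r t + ∫ τ in Ioc 0 t, g τ * r (t - τ) = g t)
    (hg0 : ∀ t, 0 ≤ t → (g t).im = 0 ∧ (g t).re ≤ 0) {t : ℝ} (ht : 0 ≤ t) :
    (r t).im = 0 ∧ (r t).re ≤ 0 := by
  have hgb := exists_bound_of_resolvent hg hr h
  have hre : ∀ s, 0 ≤ s → ∀ τ ∈ Ioc 0 s, g τ = ((g τ).re : ℂ) := fun s _ τ hτ =>
    Complex.ext rfl (hg0 τ hτ.1.le).1
  constructor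
  · have hD : ContinuousOn (fun t => ((r t).im : ℂ)) (Ici 0) :=
      Complex.continuous_ofReal.comp_continuousOn (Complex.continuous_im.comp_continuousOn hr)
    have := eq_zero_of_add_convolution_eq_zero hg hgb hD (fun s hs => ?_) ht
    · exact_mod_cast this
    · have h1 := congrArg Complex.im (h s hs)
      rw [Complex.add_im, (hg0 s hs).1] at h1
      have h2 := (integral_im (𝕜 := ℂ) (integrableOn_mul_comp_sub (hg s) hr)).symm
      simp only [RCLike.im_eq_complex_im] at h2
      rw [h2] at h1
      have h3 : ∫ τ in Ioc 0 s, g τ * ((r (s - τ)).im : ℂ) =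
          ((∫ τ in Ioc 0 s, (g τ * r (s - τ)).im : ℝ) : ℂ) := by
        rw [← integral_complex_ofReal]
        refine setIntegral_congr_fun measurableSet_Ioc fun τ hτ => ?_
        have := hre s hs τ hτ
        rw [this, ← Complex.ofReal_mul, Complex.im_ofReal_mul]
      rw [h3]
      exact_mod_cast h1
  · obtain ⟨C, hC⟩ := hgb t
    have hrr : ContinuousOn (fun s => (r s).re) (Ici 0) :=
      Complex.continuous_re.comp_continuousOn hr
    have hm : ContinuousOn (fun s => max (r s).re 0) (Ici 0) := hrr.sup continuousOn_const
    have hf : ∀ s, IntegrableOn (fun τ => -(g τ).re) (Ioc 0 s) := fun s => (hg s).re.neg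
    refine (le_max_left _ 0).trans (nonpos_of_le_convolution (m := fun s => max (r s).re 0)
      (f := fun s => -(g s).re) (C := C) (T := t) hm (fun _ _ => le_max_right _ _)
      (fun s hs => (intervalIntegrable_iff_integrableOn_Ioc_of_le hs.1).mpr (hf s))
      (fun s hs => ?_) (fun s hs => ?_) t ⟨ht, le_rfl⟩)
    · exact (neg_le_abs _).trans ((Complex.abs_re_le_norm _).trans (hC s hs))
    · rw [intervalIntegral.integral_of_le hs.1]
      have hfm : IntegrableOn (fun τ => -(g τ).re * max (r (s - τ)).re 0) (Ioc 0 s) := by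
        have := hf s
        rw [← integrableOn_Icc_iff_integrableOn_Ioc] at this ⊢
        exact this.mul_continuousOn
          (hm.comp (by fun_prop) fun _ hτ => sub_nonneg.mpr hτ.2) isCompact_Icc
      refine max_le ?_ (setIntegral_nonneg measurableSet_Ioc fun τ hτ =>
        mul_nonneg (neg_nonneg.mpr (hg0 τ hτ.1.le).2) (le_max_right _ _))
      have h1 := congrArg Complex.re (h s hs.1)
      rw [Complex.add_re] at h1
      have hint := integrableOn_mul_comp_sub (hg s) hr
      have h2 := (integral_re (𝕜 := ℂ) hint).symm
      simp only [RCLike.re_eq_complex_re] at h2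
      rw [h2] at h1
      have h4 : -∫ τ in Ioc 0 s, (g τ * r (s - τ)).re ≤
          ∫ τ in Ioc 0 s, -(g τ).re * max (r (s - τ)).re 0 := by
        rw [← integral_neg]
        refine setIntegral_mono_on hint.re.neg hfm measurableSet_Ioc fun τ hτ => ?_
        rw [hre s hs.1 τ hτ, Complex.re_ofReal_mul, Complex.ofReal_re, ← neg_mul]
        exact mul_le_mul_of_nonneg_left (le_max_left _ _)
          (neg_nonneg.mpr (hg0 τ hτ.1.le).2)
      linarith [(hg0 s hs.1).2]

namespace SuperOp

variable {N : ℕ} {P : SuperOp N}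

/-! ### Dynamics generated by multiples of a projection -/

lemma HasTimeDeriv.linearMap_apply {Λ : ℝ → SuperOp N} {D : Op N → Op N} {t : ℝ}
    (h : HasTimeDeriv Λ D t) (f : Op N →ₗ[ℂ] ℂ) (ω : Op N) :
    HasDerivWithinAt (fun s => f (Λ s ω)) (f (D ω)) (Ici 0) t := by
  have hf : ∀ X : Op N, f X = ∑ i, ∑ j, X i j * f (Matrix.single i j 1) := fun X => by
    conv_lhs => rw [matrix_eq_sum_single X]
    simp only [map_sum]
    refine Finset.sum_congr rfl fun i _ => Finset.sum_congr rfl fun j _ => ?_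
    rw [← smul_eq_mul, ← map_smul, smul_single, smul_eq_mul, mul_one]
  rw [hf (D ω)]
  simp_rw [hf (Λ _ ω)]
  exact HasDerivWithinAt.fun_sum fun i _ => HasDerivWithinAt.fun_sum fun j _ =>
    (h ω i j).mul_const _

lemma SolvesTimeLocal.hasDerivWithinAt {K Λ : ℝ → SuperOp N} (h : SolvesTimeLocal K Λ)
    {c : ℝ → ℂ} (hK : ∀ t, 0 ≤ t → K t = c t • P) (f : Op N →ₗ[ℂ] ℂ) (ω : Op N) {t : ℝ}
    (ht : 0 ≤ t) : HasDerivWithinAt (fun s => f (Λ s ω)) (c t * f (P (Λ t ω))) (Ici 0) t := by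
  have := (h.deriv t ht).linearMap_apply f ω
  simpa [hK t ht] using this

lemma SolvesTimeLocal.hasDerivWithinAt_projection (hP : P ∘ₗ P = P) {K Λ : ℝ → SuperOp N}
    (h : SolvesTimeLocal K Λ) {c : ℝ → ℂ} (hK : ∀ t, 0 ≤ t → K t = c t • P)
    (f : Op N →ₗ[ℂ] ℂ) (ω : Op N) {t : ℝ} (ht : 0 ≤ t) :
    HasDerivWithinAt (fun s => f (P (Λ s ω))) (c t * f (P (Λ t ω))) (Ici 0) t := by
  have := h.hasDerivWithinAt hK (f ∘ₗ P) ω ht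
  rwa [LinearMap.comp_apply, ← LinearMap.comp_apply P P, hP] at this

/-- The time-local master equation with generator `c(t) P` is solved by `𝟙 + (E(t) - 1) P`, where
`E' = c E`. -/
lemma SolvesTimeLocal.eq_scaling (hP : P ∘ₗ P = P) {K Λ : ℝ → SuperOp N}
    (h : SolvesTimeLocal K Λ) {c E : ℝ → ℂ} (hK : ∀ t, 0 ≤ t → K t = c t • P) (hE0 : E 0 = 1)
    (hEne : ∀ t, 0 ≤ t → E t ≠ 0)
    (hE : ∀ t, 0 ≤ t → HasDerivWithinAt E (c t * E t) (Ici 0) t) {t : ℝ} (ht : 0 ≤ t) :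
    Λ t = scaling P (E t) := by
  refine LinearMap.ext fun ω => Matrix.ext fun i j => ?_
  set f : Op N →ₗ[ℂ] ℂ := Matrix.entryLinearMap ℂ ℂ i j with hf
  have h1 : f (P (Λ t ω)) = E t * f (P ω) := by
    have := eq_of_hasDerivWithinAt_Ici_zero (f := fun s => f (P (Λ s ω)) / E s) (fun s hs =>
      ((h.hasDerivWithinAt_projection hP hK f ω hs).fun_div (hE s hs) (hEne s hs)).congr_deriv
        (by ring)) ht
    simp only [hE0, h.zero, LinearMap.id_apply, div_one] at this
    rw [div_eq_iff (hEne t ht)] at this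
    rw [this, mul_comm]
  have h2 := eq_of_hasDerivWithinAt_Ici_zero (f := fun s => f (Λ s ω) - f (P (Λ s ω)))
    (fun s hs => ((h.hasDerivWithinAt hK f ω hs).fun_sub
      (h.hasDerivWithinAt_projection hP hK f ω hs)).congr_deriv (sub_self _)) ht
  simp only [h.zero, LinearMap.id_apply, h1] at h2
  change f (Λ t ω) = f (scaling P (E t) ω)
  rw [scaling_apply, map_add, map_smul, smul_eq_mul]
  linear_combination h2

/-- For integrable `c`, the dynamics generated by `c(t) P` provides a nowhere vanishing solution of
`E' = c E`. -/
lemma SolvesTimeLocal.exists_scalar_solution (hP : P ∘ₗ P = P) (hP0 : P ≠ 0)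
    {K Λ : ℝ → SuperOp N} (h : SolvesTimeLocal K Λ) {c : ℝ → ℂ}
    (hK : ∀ t, 0 ≤ t → K t = c t • P) (hc : ∀ t, IntegrableOn c (Ioc 0 t)) :
    ∃ E : ℝ → ℂ, E 0 = 1 ∧ (∀ t, 0 ≤ t → E t ≠ 0) ∧
      ∀ t, 0 ≤ t → HasDerivWithinAt E (c t * E t) (Ici 0) t := by
  obtain ⟨ω, i, j, hω⟩ : ∃ ω i j, P ω i j ≠ 0 := by
    by_contra! hc
    exact hP0 (LinearMap.ext fun ω => Matrix.ext (hc ω))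
  set f : Op N →ₗ[ℂ] ℂ := Matrix.entryLinearMap ℂ ℂ i j with hf
  have hfω : f (P ω) ≠ 0 := hω
  have h0 : f (P (Λ 0 ω)) / f (P ω) = 1 := by rw [h.zero]; exact div_self hfω
  have hd : ∀ t, 0 ≤ t → HasDerivWithinAt (fun s => f (P (Λ s ω)) / f (P ω))
      (c t * (f (P (Λ t ω)) / f (P ω))) (Ici 0) t := fun t ht => by
    rw [← mul_div_assoc]
    exact (h.hasDerivWithinAt_projection hP hK f ω ht).div_const _
  exact ⟨_, h0, fun t ht => ne_zero_of_hasDerivWithinAt_mul h0 hc hd ht, hd⟩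

/-! ### The Redfield-like generator -/

lemma MemoryKernel.redfield_apply (K : MemoryKernel N) (t : ℝ) (ω : Op N) (i j : Fin N) :
    K.redfield t ω i j = K.inst ω i j + ∫ τ in Ioc 0 t, K.reg τ ω i j := rfl

lemma MemoryKernel.continuousOn_redfield (K : MemoryKernel N) (ω : Op N) (i j : Fin N) :
    ContinuousOn (fun t => K.redfield t ω i j) (Ici 0) :=
  continuousOn_const.add (continuousOn_Ici_primitive (K.integrableOn_reg ω i j))

lemma integral_eq_of_hasDerivWithinAt {E g : ℝ → ℂ} (hE0 : E 0 = 1)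
    (hE : ∀ t, 0 ≤ t → HasDerivWithinAt E (g t) (Ici 0) t)
    (hg : ∀ t, IntegrableOn g (Ioc 0 t)) {t : ℝ} (ht : 0 ≤ t) :
    E t = 1 + ∫ τ in Ioc 0 t, g τ := by
  rw [← intervalIntegral.integral_of_le ht,
    intervalIntegral.integral_eq_sub_of_hasDeriv_right_of_le ht
      (fun y hy => (hE y hy.1).continuousWithinAt.mono Icc_subset_Ici_self)
      (fun y hy => (hE y hy.1.le).mono fun z hz => hy.1.le.trans (le_of_lt hz))
      ((intervalIntegrable_iff_integrableOn_Ioc_of_le ht).mpr (hg t)), hE0]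
  ring

variable {K : MemoryKernel N} {Λ : ℝ → SuperOp N} {E g : ℝ → ℂ}

/-- On the kernel of `P` the dynamics is trivial, so the integrated memory kernel vanishes. -/
lemma redfield_eq_zero_of_apply_eq_zero (hNZ : SolvesIntegroDifferential K Λ)
    (hΛ : ∀ t, 0 ≤ t → Λ t = scaling P (E t)) {ω : Op N} (hω : P ω = 0) {t : ℝ} (ht : 0 ≤ t) :
    K.redfield t ω = 0 := by
  have hΛω : ∀ s, 0 ≤ s → Λ s ω = ω := fun s hs => by simp [hΛ s hs, scaling_apply, hω]
  ext i j
  have h1 := hNZ.deriv t ht ω i j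
  have h2 : HasDerivWithinAt (fun s => Λ s ω i j) 0 (Ici 0) t :=
    (hasDerivWithinAt_const t (Ici 0) (ω i j)).congr (fun s hs => by rw [hΛω s hs])
      (by rw [hΛω t ht])
  have h3 := (uniqueDiffOn_Ici 0 t ht).eq_deriv _ h1 h2
  rw [MemoryKernel.redfield_apply, Matrix.zero_apply, ← h3, MemoryKernel.conv, Matrix.add_apply,
    Matrix.of_apply, hΛω t ht]
  congr 1
  have h4 : ∫ τ in Ioc 0 t, K.reg (t - τ) (Λ τ ω) i j =
      ∫ τ in Ioc 0 t, K.reg (t - τ) ω i j :=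
    setIntegral_congr_fun measurableSet_Ioc fun τ hτ => by rw [hΛω τ hτ.1.le]
  rw [h4, ← intervalIntegral.integral_of_le ht, ← intervalIntegral.integral_of_le ht,
    intervalIntegral.integral_comp_sub_left (fun s => K.reg s ω i j) t]
  simp

/-- On the range of `P`, the integro-differential master equation is the Volterra equation
`R + g * R = g P` for the integrated memory kernel `R`. -/
lemma redfield_add_convolution (hNZ : SolvesIntegroDifferential K Λ)
    (hΛ : ∀ t, 0 ≤ t → Λ t = scaling P (E t)) (hE0 : E 0 = 1)
    (hE : ∀ t, 0 ≤ t → HasDerivWithinAt E (g t) (Ici 0) t)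
    (hg : ∀ t, IntegrableOn g (Ioc 0 t)) {ω : Op N} (hω : P ω = ω) (i j : Fin N) {t : ℝ}
    (ht : 0 ≤ t) :
    K.redfield t ω i j + ∫ τ in Ioc 0 t, g τ * K.redfield (t - τ) ω i j = g t * ω i j := by
  have hΛω : ∀ s, 0 ≤ s → Λ s ω = E s • ω := fun s hs => by
    rw [hΛ s hs, scaling_apply, hω]; module
  have h1 := hNZ.deriv t ht ω i j
  have h2 : HasDerivWithinAt (fun s => Λ s ω i j) (g t * ω i j) (Ici 0) t :=
    ((hE t ht).mul_const (ω i j)).congr (fun s hs => by rw [hΛω s hs]; rfl)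
      (by rw [hΛω t ht]; rfl)
  rw [← (uniqueDiffOn_Ici 0 t ht).eq_deriv _ h1 h2]
  simp only [MemoryKernel.redfield_apply]
  rw [← convolution_eq_add_convolution_primitive ht (hg t) (K.integrableOn_reg ω i j t)
    fun s hs => integral_eq_of_hasDerivWithinAt hE0 hE hg hs.1]
  rw [MemoryKernel.conv, Matrix.add_apply, Matrix.of_apply, hΛω t ht, map_smul]
  congr 1
  exact setIntegral_congr_fun measurableSet_Ioc fun τ hτ => by
    simp [hΛω τ hτ.1.le]

/-- The Redfield-like generator is `r(t) P`, with `r` the resolvent of `g`. -/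
lemma exists_redfield_eq_smul (hP : P ∘ₗ P = P) (hP0 : P ≠ 0)
    (hNZ : SolvesIntegroDifferential K Λ)
    (hΛ : ∀ t, 0 ≤ t → Λ t = scaling P (E t)) (hE0 : E 0 = 1)
    (hE : ∀ t, 0 ≤ t → HasDerivWithinAt E (g t) (Ici 0) t)
    (hg : ∀ t, IntegrableOn g (Ioc 0 t)) :
    ∃ r : ℝ → ℂ, ContinuousOn r (Ici 0) ∧
      (∀ t, 0 ≤ t → r t + ∫ τ in Ioc 0 t, g τ * r (t - τ) = g t) ∧
      ∀ t, 0 ≤ t → K.redfield t = r t • P := by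
  have hPP : ∀ ω, P (P ω) = P ω := fun ω => LinearMap.congr_fun hP ω
  obtain ⟨ω₀, i₀, j₀, hω₀⟩ : ∃ ω i j, P ω i j ≠ 0 := by
    by_contra! hc
    exact hP0 (LinearMap.ext fun ω => Matrix.ext (hc ω))
  set r : ℝ → ℂ := fun t => K.redfield t (P ω₀) i₀ j₀ / P ω₀ i₀ j₀ with hr
  have hrc : ContinuousOn r (Ici 0) := (K.continuousOn_redfield _ _ _).div_const _
  have hres : ∀ t, 0 ≤ t → r t + ∫ τ in Ioc 0 t, g τ * r (t - τ) = g t := fun t ht => by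
    have := redfield_add_convolution hNZ hΛ hE0 hE hg (hPP ω₀) i₀ j₀ ht
    simp only [hr, ← mul_div_assoc, integral_div]
    rw [← add_div, this, mul_div_cancel_right₀ _ hω₀]
  refine ⟨r, hrc, hres, fun t ht => LinearMap.ext fun ω => ?_⟩
  have h1 : K.redfield t ω = K.redfield t (P ω) := by
    have := redfield_eq_zero_of_apply_eq_zero hNZ hΛ (ω := ω - P ω) (by simp [hPP]) ht
    rwa [map_sub, sub_eq_zero] at this
  rw [h1, LinearMap.smul_apply]
  ext i j
  have hDc := (K.continuousOn_redfield (P ω) i j).sub (hrc.mul_const (P ω i j))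
  refine sub_eq_zero.mp (eq_zero_of_add_convolution_eq_zero hg
    (exists_bound_of_resolvent hg hrc hres) hDc (fun s hs => ?_) ht)
  have h2 := redfield_add_convolution hNZ hΛ hE0 hE hg (hPP ω) i j hs
  have h3 := hres s hs
  simp only [Pi.sub_apply, mul_sub, ← mul_assoc]
  rw [integral_sub (integrableOn_mul_comp_sub (hg s) (K.continuousOn_redfield _ _ _))
    ((integrableOn_mul_comp_sub (hg s) hrc).mul_const _), integral_mul_const]
  linear_combination h2 - P ω i j * h3

/-! ### Divisibility -/

/-- If a class `C` of positive trace-preserving maps, closed under composition and convex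
combinations, contains `𝟙 + (e - 1) P` for some real `e < 1`, then it does so for all
`0 < q ≤ 1`. -/
lemma scaling_mem_of_lt_one (hP : P ∘ₗ P = P) {C : SuperOp N → Prop} (hid : C LinearMap.id)
    (hcomp : ∀ Φ Ψ, C Φ → C Ψ → C (Φ ∘ₗ Ψ))
    (hconv : ∀ Φ Ψ, C Φ → C Ψ → ∀ a b : ℝ, 0 ≤ a → 0 ≤ b → a + b = 1 →
      C ((a : ℂ) • Φ + (b : ℂ) • Ψ))
    {e : ℝ} (he1 : e < 1) (he : C (scaling P e)) {q : ℝ} (hq0 : 0 < q)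
    (hq1 : q ≤ 1) : C (scaling P q) := by
  have hpow : ∀ n : ℕ, C (scaling P ((e ^ n : ℝ) : ℂ)) := by
    intro n
    induction n with
    | zero => simpa using hid
    | succ n ih =>
      have := hcomp _ _ ih he
      rw [scaling_comp hP] at this
      simpa [pow_succ] using this
  obtain ⟨n, hn⟩ := exists_pow_lt_of_lt_one hq0 he1
  have hpos : 0 < 1 - e ^ n := by linarith
  have hsum : (1 - (1 - q) / (1 - e ^ n)) + (1 - q) / (1 - e ^ n) = 1 := by ring
  have := hconv _ _ hid (hpow n) (1 - (1 - q) / (1 - e ^ n)) ((1 - q) / (1 - e ^ n))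
    (sub_nonneg.mpr ((div_le_one hpos).mpr (by linarith)))
    (div_nonneg (by linarith) hpos.le) hsum
  rw [convexComb_scaling hsum] at this
  convert this using 2
  norm_cast
  field_simp
  ring

/-- Divisibility with propagators in a class `C` passes from the exact to the Redfield-like
dynamics. -/
lemma redfield_divisible {L : SuperOp N} {ℓ : ℂ} {γ : ℝ → ℝ} {ΛRed : ℝ → SuperOp N}
    {C : SuperOp N → Prop}
    (hC : ∀ Φ, C Φ → Φ.IsPositiveMap ∧ Φ.IsTracePreserving) (hid : C LinearMap.id)
    (hcomp : ∀ Φ Ψ, C Φ → C Ψ → C (Φ ∘ₗ Ψ))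
    (hconv : ∀ Φ Ψ, C Φ → C Ψ → ∀ a b : ℝ, 0 ≤ a → 0 ≤ b → a + b = 1 →
      C ((a : ℂ) • Φ + (b : ℂ) • Ψ))
    (hγ : ∀ t, IntegrableOn γ (Ioc 0 t)) (hL : HasOnlyNonzeroEigenvalue L ℓ)
    (hTCL : SolvesTimeLocal (fun t => ((γ t : ℝ) : ℂ) • L) Λ)
    (hNZ : SolvesIntegroDifferential K Λ) (hRed : SolvesTimeLocal K.redfield ΛRed)
    (hdiv : ∀ s t, 0 ≤ s → s ≤ t → ∃ V, C V ∧ Λ t = V ∘ₗ Λ s) :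
    ∀ s t, 0 ≤ s → s ≤ t → ∃ V, C V ∧ ΛRed t = V ∘ₗ ΛRed s := by
  obtain ⟨P, hP, hP0, rfl⟩ := hL.exists_projection
  have hK : ∀ t : ℝ, 0 ≤ t → ((γ t : ℝ) : ℂ) • ℓ • P = ((γ t : ℂ) * ℓ) • P :=
    fun t _ => smul_smul _ _ _
  have hc : ∀ t, IntegrableOn (fun t => (γ t : ℂ) * ℓ) (Ioc 0 t) := fun t =>
    (hγ t).ofReal.mul_const ℓ
  obtain ⟨E, hE0, hEne, hE⟩ := hTCL.exists_scalar_solution hP hP0 hK hc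
  have hΛ : ∀ t, 0 ≤ t → Λ t = scaling P (E t) := fun t ht =>
    hTCL.eq_scaling hP hK hE0 hEne hE ht
  have hEc : ContinuousOn E (Ici 0) := fun t ht => (hE t ht).continuousWithinAt
  have hg : ∀ t, IntegrableOn (fun t => (γ t : ℂ) * ℓ * E t) (Ioc 0 t) := fun t => by
    have := hc t
    rw [← integrableOn_Icc_iff_integrableOn_Ioc] at this ⊢
    exact this.mul_continuousOn (hEc.mono Icc_subset_Ici_self) isCompact_Icc
  set g : ℝ → ℂ := fun t => (γ t : ℂ) * ℓ * E t with hgdef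
  obtain ⟨r, hrc, hres, hKr⟩ := exists_redfield_eq_smul (g := g) hP hP0 hNZ hΛ hE0 hE hg
  obtain ⟨F, hF, hFd⟩ := exists_exp_primitive hrc
  have hFne : ∀ t, 0 ≤ t → F t ≠ 0 := fun t ht => by rw [hF t ht]; exact Complex.exp_ne_zero _
  have hΛR : ∀ t, 0 ≤ t → ΛRed t = scaling P (F t) := fun t ht =>
    hRed.eq_scaling hP hKr (by simp [hF 0 le_rfl]) hFne hFd ht
  -- the exact propagators are determined by the invertible maps `Λ s`
  have hprop : ∀ s t, 0 ≤ s → s ≤ t → C (scaling P (E t / E s)) := by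
    intro s t hs hst
    obtain ⟨V, hV, hVeq⟩ := hdiv s t hs hst
    rw [hΛ t (hs.trans hst), hΛ s hs] at hVeq
    rwa [← eq_scaling_div hP (hEne s hs) hVeq]
  have him : ∀ t, 0 ≤ t → (E t).im = 0 := fun t ht => by
    have := (hC _ (hprop 0 t le_rfl ht)).1.im_eq_zero hP hP0
    rwa [hE0, div_one] at this
  have hre : ∀ t, 0 ≤ t → E t = ((E t).re : ℂ) := fun t ht => Complex.ext rfl (him t ht)
  have hErc : ContinuousOn (fun t => (E t).re) (Ici 0) :=
    Complex.continuous_re.comp_continuousOn hEc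
  have hEpos : ∀ t, 0 ≤ t → 0 < (E t).re := by
    intro t ht
    by_contra! hneg
    obtain ⟨s, hs, hs0⟩ := intermediate_value_Icc' ht (hErc.mono Icc_subset_Ici_self)
      (show (0 : ℝ) ∈ Icc (E t).re (E 0).re from ⟨hneg, by simp [hE0]⟩)
    exact hEne s hs.1 (Complex.ext hs0 (him s hs.1))
  have hanti : AntitoneOn (fun t => (E t).re) (Ici 0) := by
    intro s hs t ht hst
    have h := hC _ (hprop s t hs hst)
    rw [hre t ht, hre s hs, ← Complex.ofReal_div] at h
    exact (div_le_one (hEpos s hs)).mp (h.1.re_le_one hP hP0 h.2)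
  have hg0 : ∀ t, 0 ≤ t → (g t).im = 0 ∧ (g t).re ≤ 0 := by
    intro t ht
    have hu := uniqueDiffOn_Ici (0 : ℝ) t ht
    constructor
    · have h1 : HasDerivWithinAt (fun s => (E s).im) (g t).im (Ici 0) t :=
        Complex.imCLM.hasFDerivAt.comp_hasDerivWithinAt t (hE t ht)
      exact hu.eq_deriv _ h1
        ((hasDerivWithinAt_const t (Ici 0) (0 : ℝ)).congr (fun s hs => him s hs) (him t ht))
    · have h1 : HasDerivWithinAt (fun s => (E s).re) (g t).re (Ici 0) t :=
        Complex.reCLM.hasFDerivAt.comp_hasDerivWithinAt t (hE t ht)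
      rw [← h1.derivWithin hu]
      exact hanti.derivWithin_nonpos
  have hr0 : ∀ t, 0 ≤ t → (r t).im = 0 ∧ (r t).re ≤ 0 := fun t ht =>
    resolvent_nonpos hg hrc hres hg0 ht
  have hri : ∀ s t, 0 ≤ s → s ≤ t → IntervalIntegrable r volume s t := fun s t hs hst =>
    (hrc.mono fun x hx => by rw [uIcc_of_le hst] at hx; exact hs.trans hx.1).intervalIntegrable
  have hFdiv : ∀ s t, 0 ≤ s → s ≤ t →
      F t / F s = ((Real.exp (∫ x in s..t, (r x).re) : ℝ) : ℂ) := by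
    intro s t hs hst
    rw [hF t (hs.trans hst), hF s hs, ← Complex.exp_sub,
      intervalIntegral.integral_interval_sub_left (hri 0 t le_rfl (hs.trans hst))
        (hri 0 s le_rfl hs), Complex.ofReal_exp, ← intervalIntegral.integral_ofReal]
    congr 1
    refine intervalIntegral.integral_congr fun x hx => ?_
    rw [uIcc_of_le hst] at hx
    exact Complex.ext rfl (hr0 x (hs.trans hx.1)).1
  intro s t hs hst
  refine ⟨scaling P (F t / F s), ?_, ?_⟩
  · by_cases htriv : ∀ t, 0 ≤ t → E t = 1
    · -- trivial exact dynamics: `g = 0`, hence `r = 0` and `F = 1`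
      have hgz : ∀ x, 0 ≤ x → g x = 0 := fun x hx =>
        (uniqueDiffOn_Ici (0 : ℝ) x hx).eq_deriv _ (hE x hx)
          ((hasDerivWithinAt_const x (Ici 0) (1 : ℂ)).congr (fun y hy => htriv y hy)
            (htriv x hx))
      have hrz : ∀ x, 0 ≤ x → r x = 0 := fun x hx => by
        have h1 : r x + ∫ τ in Ioc 0 x, g τ * r (x - τ) = g x := hres x hx
        rw [hgz x hx, setIntegral_congr_fun (g := fun _ => (0 : ℂ)) measurableSet_Ioc
          (fun y hy => by rw [hgz y hy.1.le, zero_mul])] at h1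
        simpa using h1
      rw [hFdiv s t hs hst, intervalIntegral.integral_congr (g := fun _ => (0 : ℝ))
        (fun x hx => by
          rw [uIcc_of_le hst] at hx
          simp [hrz x (hs.trans hx.1)])]
      simpa using hid
    · push Not at htriv
      obtain ⟨t₀, ht₀, hne⟩ := htriv
      have hlt : (E t₀).re < 1 := by
        refine lt_of_le_of_ne (by simpa [hE0] using hanti self_mem_Ici ht₀ ht₀) fun h => hne ?_
        rw [hre t₀ ht₀, h, Complex.ofReal_one]
      have hmem : C (scaling P ((E t₀).re : ℂ)) := by
        have := hprop 0 t₀ le_rfl ht₀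
        rwa [hE0, div_one, hre t₀ ht₀] at this
      rw [hFdiv s t hs hst]
      refine scaling_mem_of_lt_one hP hid hcomp hconv hlt hmem (Real.exp_pos _)
        (Real.exp_le_one_iff.mpr ?_)
      rw [← neg_nonneg, ← intervalIntegral.integral_neg]
      exact intervalIntegral.integral_nonneg hst fun x hx =>
        neg_nonneg.mpr (hr0 x (hs.trans hx.1)).2
  · rw [hΛR t (hs.trans hst), hΛR s hs, scaling_comp hP, div_mul_cancel₀ _ (hFne s hs)]

end SuperOp

open SuperOp in
theorem corollary2 (N : ℕ)
    -- the exact dynamics, with its time-local generator and its memory kernel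
    (Λ : ℝ → SuperOp N) (hΛ : IsDynamicalMap Λ)
    (γ : ℝ → ℝ) (hγ : ∀ t, IntegrableOn γ (Ioc 0 t))
    (L : SuperOp N) (ℓ : ℂ) (hL : HasOnlyNonzeroEigenvalue L ℓ)
    (hTCL : SolvesTimeLocal (fun t => ((γ t : ℝ) : ℂ) • L) Λ)
    (KNZ : MemoryKernel N) (hNZ : SolvesIntegroDifferential KNZ Λ)
    -- the Laplace transform of `G` exists and has modulus less than one
    -- (in some right half-plane)
    (hG : ∃ c : ℝ, ∀ u : ℂ, c < u.re →
      LaplaceConvergent (G ℓ γ) u ∧ ‖laplace (G ℓ γ) u‖ < 1)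
    -- the Redfield-like dynamics
    (ΛRed : ℝ → SuperOp N) (hRed : SolvesTimeLocal KNZ.redfield ΛRed) :
    (IsPDivisible Λ → IsPDivisible ΛRed) ∧ (IsCPDivisible Λ → IsCPDivisible ΛRed) := by
  refine ⟨fun h s t hs hst => ?_, fun h s t hs hst => ?_⟩
  · obtain ⟨V, ⟨hV, hVtr⟩, hVeq⟩ := redfield_divisible
      (C := fun Φ => Φ.IsPositiveMap ∧ Φ.IsTracePreserving) (fun _ hΦ => hΦ)
      ⟨isPositiveMap_id, isTracePreserving_id⟩
      (fun _ _ hΦ hΨ => ⟨hΦ.1.comp hΨ.1, hΦ.2.comp hΨ.2⟩)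
      (fun _ _ hΦ hΨ _ _ ha hb hab => ⟨hΦ.1.convexComb hΨ.1 ha hb, hΦ.2.convexComb hΨ.2 hab⟩)
      hγ hL hTCL hNZ hRed (fun s t hs hst => by simpa only [and_assoc] using h s t hs hst)
      s t hs hst
    exact ⟨V, hV, hVtr, hVeq⟩
  · obtain ⟨V, ⟨hV, hVtr⟩, hVeq⟩ := redfield_divisible
      (C := fun Φ => Φ.IsCompletelyPositiveMap ∧ Φ.IsTracePreserving)
      (fun _ hΦ => ⟨hΦ.1.isPositiveMap, hΦ.2⟩)
      ⟨isCompletelyPositiveMap_id, isTracePreserving_id⟩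
      (fun _ _ hΦ hΨ => ⟨hΦ.1.comp hΨ.1, hΦ.2.comp hΨ.2⟩)
      (fun _ _ hΦ hΨ _ _ ha hb hab => ⟨hΦ.1.convexComb hΨ.1 ha hb, hΦ.2.convexComb hΨ.2 hab⟩)
      hγ hL hTCL hNZ hRed (fun s t hs hst => by simpa only [and_assoc] using h s t hs hst)
      s t hs hst
    exact ⟨V, hV, hVtr, hVeq⟩
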